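/- Fix the following notions. For a class $F$ of functions $X\to Y$, a hidden $f\in F$ is to be learned online by a deterministic learner: in each round the learner receives an input $x\in X$ chosen by an adversary and guesses $f(x)$; under standard feedback it is then told $f(x)$, under bandit feedback only whether its guess was correct. Let $\mathrm{opt}_{\mathrm{std}}(F)$ and $\mathrm{opt}_{\mathrm{bs}}(F)$ in $\mathbb{N}\cup\{\infty\}$ be the minimum, over all learners, of the worst-case number of mistakes (over all $f\in F$ and all input sequences) under standard and bandit feedback respectively. Let $\mathrm{CART}_r(F)$ be the class of all functions $X^r\to Y^r$ of the form $(x_1,\dots,x_r)\mapsto(f(x_1),\dots,f(x_r))$ with $f\in F$. A class $G$ of functions $X'\to Y'$ dominates $F$ if there are maps $M:F\to G$ and $m:X\to X'$, and for each $x\in X$ a bijection $s_x:Y\to Y'$, such that $M(f)(m(x))=s_x(f(x))$ for all $f\in F$ and $x\in X$. For a prime power $k$ and $n\ge 1$, let $F_L(k,n)$ be the class of all linear maps $\mathbb{F}_k^n\to\mathbb{F}_k$, and let $F_{k,n}$ be the class of all functions $\mathbb{Z}\to\mathbb{F}_k$ that output $0$ on all but at most $n$ inputs (the $k$ possible outputs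 being labelled by the elements of $\mathbb{F}_k$). Let $F^*_{k,n}$ be the class of all functions $\mathbb{F}_k^n\sqcup\mathbb{Z}\to\mathbb{F}_k$ whose restriction to $\mathbb{F}_k^n$ lies in $F_L(k,n)$ and whose restriction to $\mathbb{Z}$ lies in $F_{k,n}$. **Theorem.** There is an absolute constant $c>0$ such that for every prime power $k$ and every integer $n\ge2$, the class $F^*_{k,n}$, which has $k$ outputs, dominates both $F_L(k,n)$ and $F_{k,n}$ and satisfies 1. $\mathrm{opt}_{\mathrm{std}}(F^*_{k,n})\le 2n$, 2. $\mathrm{opt}_{\mathrm{bs}}(F^*_{k,n})\ge c\,nk\ln k$, and 3. $\mathrm{opt}_{\mathrm{bs}}(\mathrm{CART}_r(F^*_{k,n}))\ge k^n-1$ for every integer $r\ge n$. -/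

import Mathlib

open scoped ENNReal

namespace OnlineLearning

/-- A deterministic learner. Given the history (most recent round first; each round records the
input, the learner's guess and the feedback received) and the current input, it makes a guess. -/
def Learner (X Y Φ : Type*) : Type _ := List (X × Y × Φ) → X → Y

open Classical in
/-- Number of mistakes that the learner `A` makes on the remaining inputs, after history `H`, when
the hidden function is `f` and the feedback to the guess `y` for `f x` is `fb (f x) y`. -/
noncomputable def mistakes {X Y Φ : Type*} (fb : Y → Y → Φ) (A : Learner X Y Φ) (f : X → Y) :
    List (X × Y × Φ) → List X → ℕ
  | _, [] => 0
  | H, x :: xs =>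
      (if A H x = f x then 0 else 1) +
        mistakes fb A f ((x, A H x, fb (f x) (A H x)) :: H) xs

/-- Worst-case number of mistakes of the learner `A` over all hidden functions in `F` and all
finite sequences of inputs. -/
noncomputable def worstCase {X Y Φ : Type*} (fb : Y → Y → Φ) (A : Learner X Y Φ)
    (F : Set (X → Y)) : ℕ∞ :=
  ⨆ f ∈ F, ⨆ xs : List X, (mistakes fb A f [] xs : ℕ∞)

/-- The optimal worst-case mistake bound for `F` with feedback `fb`. -/
noncomputable def opt {X Y Φ : Type*} (fb : Y → Y → Φ) (F : Set (X → Y)) : ℕ∞ :=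
  ⨅ A : Learner X Y Φ, worstCase fb A F

/-- Standard (strong) reinforcement: the correct output is revealed after every guess. -/
noncomputable def optStd {X Y : Type*} (F : Set (X → Y)) : ℕ∞ :=
  opt (fun truth _ : Y => truth) F

/-- Bandit (weak) reinforcement: only the truth value of "the guess is correct" is revealed. -/
noncomputable def optBs {X Y : Type*} (F : Set (X → Y)) : ℕ∞ :=
  opt (fun truth guess : Y => (guess = truth : Prop)) F

/-- The class of functions `(x₁, …, x_r) ↦ (f x₁, …, f x_r)` with `f ∈ F`. -/
def CART {X Y : Type*} (r : ℕ) (F : Set (X → Y)) : Set ((Fin r → X) → (Fin r → Y)) :=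
  {g | ∃ f ∈ F, ∀ (x : Fin r → X) (i : Fin r), g x i = f (x i)}

/-- `G` dominates `F`. -/
def Dominates {X Y X' Y' : Type*} (G : Set (X' → Y')) (F : Set (X → Y)) : Prop :=
  ∃ (M : F → G) (m : X → X') (s : X → Y ≃ Y'),
    ∀ (f : F) (x : X), (M f : X' → Y') (m x) = s x ((f : X → Y) x)

/-- The class of linear maps from `Kⁿ` to `K`. -/
def linearClass (K : Type*) [Field K] (n : ℕ) : Set ((Fin n → K) → K) :=
  {f | ∃ L : (Fin n → K) →ₗ[K] K, ∀ x, f x = L x}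

/-- The class of functions on `ℤ` that output `0` on all but at most `n` inputs. -/
def sparseClass (Y : Type*) [Zero Y] (n : ℕ) : Set (ℤ → Y) :=
  {h | {x : ℤ | h x ≠ 0}.encard ≤ n}

/-- The functions on the disjoint union of two domains whose restriction to the first lies in `F`
and whose restriction to the second lies in `G`, the two being chosen independently. -/
def disjointUnionClass {X X' Y : Type*} (F : Set (X → Y)) (G : Set (X' → Y)) :
    Set (X ⊕ X' → Y) :=
  {g | ∃ f ∈ F, ∃ h ∈ G, g = Sum.elim f h}

/-- The class `F*_{k,n}`, where `k` is the number of elements of the finite field `K`. -/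
def starClass (K : Type*) [Field K] (n : ℕ) : Set ((Fin n → K) ⊕ ℤ → K) :=
  disjointUnionClass (linearClass K n) (sparseClass K n)

end OnlineLearning

namespace OnlineLearning

/-! Both lower bounds use only the linear part, with an adversary that rejects every guess
(`CanReject`). A random vector `x` hashes the coefficient vectors by `u ⬝ᵥ x` pairwise
independently, so by the second moment some `x` spreads a large set of them evenly
(`exists_even_hash`). Rejecting half of the values at `x` then costs only a factor 4, so about `n
log k` stages of `k / 2` rejections fit into `k ^ n` candidates (`canReject_dotFun`). In `CART`, one
input can hold a whole basis, so a rejected guess excludes at most one linear map.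

The upper bound is a potential argument (`mistakes_consistentLearner_add_le`): each mistake either
enlarges the span of the queried vectors or reveals a new integer of the support, and each happens
at most `n` times. -/

/-! ### The adversary that always rejects the guess -/

/-- Against a learner with bandit feedback, the adversary can reject `t` guesses in a row while
keeping some function of `R` consistent with all the answers. -/
def CanReject {X Y : Type*} : Set (X → Y) → ℕ → Prop
  | R, 0 => R.Nonempty
  | R, t + 1 => ∃ x, ∀ y, CanReject {f ∈ R | f x ≠ y} t

theorem CanReject.mono {X Y : Type*} {R R' : Set (X → Y)} (h : R ⊆ R') {t : ℕ}
    (hR : CanReject R t) : CanReject R' t := by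
  induction t generalizing R R' with
  | zero => exact Set.Nonempty.mono h hR
  | succ t ih =>
    obtain ⟨x, hx⟩ := hR
    exact ⟨x, fun y => ih (fun f hf => ⟨h hf.1, hf.2⟩) (hx y)⟩

/-- Rejecting `b` guesses on the same input excludes at most `b` values at this input. -/
theorem CanReject.repeat_input {X Y : Type*} {R : Set (X → Y)} (x : X) {b t : ℕ}
    (h : ∀ B : Finset Y, B.card ≤ b → CanReject {f ∈ R | f x ∉ B} t) :
    CanReject R (b + t) := by
  classical
  induction b generalizing R with
  | zero =>
    rw [Nat.zero_add]
    exact (h ∅ (by simp)).mono fun f hf => hf.1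
  | succ b ih =>
    rw [show b + 1 + t = (b + t) + 1 by ring]
    refine ⟨x, fun y => ih fun B hB => ?_⟩
    refine (h (insert y B) ((Finset.card_insert_le _ _).trans (by omega))).mono ?_
    rintro f ⟨hf, hfB⟩
    simp only [Finset.mem_insert, not_or] at hfB
    exact ⟨⟨hf, hfB.1⟩, hfB.2⟩

/-- The learner is deterministic, so the adversary knows each guess in advance. The surviving
function agrees with every rejection, hence replaying the inputs against it produces the same
history. -/
theorem CanReject.exists_mistakes {X Y : Type*} {R : Set (X → Y)} {t : ℕ} (hR : CanReject R t)
    (A : Learner X Y Prop) (H : List (X × Y × Prop)) :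
    ∃ f ∈ R, ∃ xs : List X, mistakes (fun truth guess : Y => guess = truth) A f H xs = t := by
  induction t generalizing R H with
  | zero =>
    obtain ⟨f, hf⟩ := hR
    exact ⟨f, hf, [], rfl⟩
  | succ t ih =>
    obtain ⟨x, hx⟩ := hR
    obtain ⟨f, ⟨hf, hne⟩, xs, hxs⟩ := ih (hx (A H x)) ((x, A H x, False) :: H)
    refine ⟨f, hf, x :: xs, ?_⟩
    have hF : (A H x = f x) = False := eq_false fun h => hne h.symm
    simp only [mistakes, hF, if_false]
    rw [hxs, Nat.add_comm]

theorem CanReject.le_optBs {X Y : Type*} {F : Set (X → Y)} {t : ℕ} (h : CanReject F t) :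
    (t : ℕ∞) ≤ optBs F := by
  refine le_iInf fun A => ?_
  obtain ⟨f, hf, xs, hxs⟩ := h.exists_mistakes A []
  refine le_trans (le_of_eq ?_) (le_iSup₂_of_le f hf (le_iSup _ xs))
  exact congrArg _ hxs.symm

/-! ### Hashing by a random linear form -/

section Hashing

variable {K : Type*} [Field K] [Fintype K]

-- A nonzero linear form is onto, so its kernel is a hyperplane. Applied to `u - v`, this gives the
-- collision probability `1 / k` of distinct `u` and `v`.
open Classical in
theorem card_mul_card_dotProduct_eq_zero {n : ℕ} {w : Fin n → K} (hw : w ≠ 0) :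
    Fintype.card K * (Finset.univ.filter fun x : Fin n → K => w ⬝ᵥ x = 0).card
      = Fintype.card K ^ n := by
  let L : (Fin n → K) →ₗ[K] K := dotProductBilin K K w
  have hL : ∀ x, L x = w ⬝ᵥ x := fun x => rfl
  have hsurj : Function.Surjective L := by
    refine LinearMap.surjective fun h => hw ?_
    refine dotProduct_eq_zero w fun v => ?_
    rw [← hL, h, LinearMap.zero_apply]
  have h1 := LinearMap.finrank_range_add_finrank_ker L
  rw [LinearMap.range_eq_top.2 hsurj, finrank_top, Module.finrank_self, Module.finrank_fin_fun] at h1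
  have h2 : (Finset.univ.filter fun x : Fin n → K => w ⬝ᵥ x = 0).card
      = Fintype.card (LinearMap.ker L) := by
    rw [Fintype.card_subtype]
    congr 1
  rw [h2, Module.card_eq_pow_finrank (K := K) (V := LinearMap.ker L), ← pow_succ', Nat.add_comm, h1]

open Classical in
/-- Some linear form has few collisions on `R`. -/
theorem exists_few_collisions {n : ℕ} (R : Finset (Fin n → K)) :
    ∃ x : Fin n → K,
      Fintype.card K * ((R ×ˢ R).filter fun p => p.1 ⬝ᵥ x = p.2 ⬝ᵥ x).card
        ≤ Fintype.card K * R.card + R.card ^ 2 := by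
  set k := Fintype.card K
  have key : ∑ x : Fin n → K, k * ((R ×ˢ R).filter fun p => p.1 ⬝ᵥ x = p.2 ⬝ᵥ x).card
      ≤ ∑ _x : Fin n → K, (k * R.card + R.card ^ 2) := by
    have h1 : ∑ x : Fin n → K, k * ((R ×ˢ R).filter fun p => p.1 ⬝ᵥ x = p.2 ⬝ᵥ x).card
        = ∑ p ∈ R ×ˢ R, k * (Finset.univ.filter fun x : Fin n → K => p.1 ⬝ᵥ x = p.2 ⬝ᵥ x).card := by
      simp_rw [← Finset.mul_sum, Finset.card_filter]
      rw [Finset.sum_comm]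
    -- Adding `k ^ n` on the diagonal too is wasteful, but makes the sum over all pairs exact.
    have h2 : ∀ p ∈ R ×ˢ R,
        k * (Finset.univ.filter fun x : Fin n → K => p.1 ⬝ᵥ x = p.2 ⬝ᵥ x).card
          ≤ (if p.1 = p.2 then k * k ^ n else 0) + k ^ n := by
      rintro ⟨u, v⟩ -
      by_cases huv : u = v
      · subst huv
        simp [k]
      · have := card_mul_card_dotProduct_eq_zero (sub_ne_zero.2 huv)
        simp only [sub_dotProduct, sub_eq_zero] at this
        simp [huv, this, k]
    have h3 : ((R ×ˢ R).filter fun p => p.1 = p.2).card = R.card := by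
      rw [← Finset.diag_eq_filter, Finset.diag_card]
    rw [h1]
    refine (Finset.sum_le_sum h2).trans (le_of_eq ?_)
    rw [Finset.sum_add_distrib, ← Finset.sum_filter, Finset.sum_const, Finset.sum_const, h3,
      Finset.sum_const, Finset.card_product, Finset.card_univ, Fintype.card_fun, Fintype.card_fin]
    simp only [smul_eq_mul]
    ring
  obtain ⟨x, -, hx⟩ := Finset.exists_le_of_sum_le Finset.univ_nonempty key
  exact ⟨x, hx⟩

open Classical in
/-- If `R` is large, then some linear form hashes it so evenly that excluding half of the hash
values leaves a quarter of `R`. -/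
theorem exists_even_hash {n : ℕ} (R : Finset (Fin n → K)) (hR : 8 * Fintype.card K ≤ R.card) :
    ∃ x : Fin n → K, ∀ B : Finset K, B.card ≤ Fintype.card K / 2 →
      R.card ≤ 4 * (R.filter fun u => u ⬝ᵥ x ∉ B).card := by
  obtain ⟨x, hx⟩ := exists_few_collisions R
  refine ⟨x, fun B hB => ?_⟩
  set k := Fintype.card K with hk
  have hk0 : 0 < k := Fintype.card_pos
  let N : K → ℕ := fun y => (R.filter fun u => u ⬝ᵥ x = y).card
  have hN : ∑ y, N y = R.card :=
    (Finset.card_eq_sum_card_fiberwise fun _ _ => Finset.mem_coe.2 (Finset.mem_univ _)).symm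
  have hNB : ∑ y ∈ B, N y = (R.filter fun u => u ⬝ᵥ x ∈ B).card := by
    rw [Finset.card_eq_sum_card_fiberwise (s := R.filter fun u => u ⬝ᵥ x ∈ B)
      (f := fun u => u ⬝ᵥ x) (t := B) fun u hu => (Finset.mem_filter.1 (Finset.mem_coe.1 hu)).2]
    refine Finset.sum_congr rfl fun y hy => congrArg Finset.card ?_
    ext u
    simp only [Finset.mem_filter]
    exact ⟨fun h => ⟨⟨h.1, h.2 ▸ hy⟩, h.2⟩, fun h => ⟨h.1.1, h.2⟩⟩
  have hN2 : ((R ×ˢ R).filter fun p => p.1 ⬝ᵥ x = p.2 ⬝ᵥ x).card = ∑ y, N y ^ 2 := by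
    rw [Finset.card_eq_sum_card_fiberwise (f := fun p => p.1 ⬝ᵥ x) (t := Finset.univ)
      fun _ _ => Finset.mem_coe.2 (Finset.mem_univ _)]
    refine Finset.sum_congr rfl fun y _ => ?_
    rw [sq, ← Finset.card_product]
    refine congrArg _ ?_
    ext ⟨u, v⟩
    simp only [Finset.mem_filter, Finset.mem_product]
    constructor
    · rintro ⟨⟨⟨hu, hv⟩, h⟩, h'⟩
      exact ⟨⟨hu, h'⟩, hv, h ▸ h'⟩
    · rintro ⟨⟨hu, h'⟩, hv, h⟩
      exact ⟨⟨⟨hu, hv⟩, h'.trans h.symm⟩, h'⟩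
  have hsplit : (R.filter fun u => u ⬝ᵥ x ∈ B).card + (R.filter fun u => u ⬝ᵥ x ∉ B).card
      = R.card := Finset.card_filter_add_card_filter_not (fun u => u ⬝ᵥ x ∈ B)
  rw [hN2] at hx
  by_contra! hcon
  -- Chebyshev's argument: if few elements survive, the fibres over `B` are too heavy on average for
  -- the variance bound `hvar`.
  have hcs := sq_sum_le_card_mul_sum_sq (s := B) (f := fun y => (k : ℝ) * N y - R.card)
  have hsub : ∑ y ∈ B, ((k : ℝ) * N y - R.card) ^ 2 ≤ ∑ y, ((k : ℝ) * N y - R.card) ^ 2 :=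
    Finset.sum_le_univ_sum_of_nonneg fun y => sq_nonneg _
  have hN' : ∑ y, (N y : ℝ) = R.card := by exact_mod_cast hN
  have hNB' : ∑ y ∈ B, (N y : ℝ) = R.card - (R.filter fun u => u ⬝ᵥ x ∉ B).card := by
    rw [eq_sub_iff_add_eq]
    exact_mod_cast (congrArg (· + (R.filter fun u => u ⬝ᵥ x ∉ B).card) hNB).trans hsplit
  have hx' : (k : ℝ) * ∑ y, (N y : ℝ) ^ 2 ≤ k * R.card + (R.card : ℝ) ^ 2 := by exact_mod_cast hx
  have hvar : ∑ y, ((k : ℝ) * N y - R.card) ^ 2 ≤ (k : ℝ) ^ 2 * R.card := by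
    have : ∑ y, ((k : ℝ) * N y - R.card) ^ 2
        = k * (k * ∑ y, (N y : ℝ) ^ 2) - 2 * k * R.card * ∑ y, (N y : ℝ) + k * (R.card : ℝ) ^ 2 := by
      simp only [sub_sq, mul_pow, Finset.sum_add_distrib, Finset.sum_sub_distrib, Finset.mul_sum,
        Finset.sum_const, Finset.card_univ, nsmul_eq_mul]
      congr 2
      · exact Finset.sum_congr rfl fun y _ => by ring
      · exact Finset.sum_congr rfl fun y _ => by ring
    rw [this, hN']
    nlinarith [mul_le_mul_of_nonneg_left hx' (Nat.cast_nonneg (α := ℝ) k)]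
  rw [Finset.sum_sub_distrib, ← Finset.mul_sum, hNB', Finset.sum_const, nsmul_eq_mul] at hcs
  have hb : 2 * (B.card : ℝ) ≤ k := by
    have : 2 * B.card ≤ k := by omega
    exact_mod_cast this
  have ha : 4 * ((R.filter fun u => u ⬝ᵥ x ∉ B).card : ℝ) < R.card := by exact_mod_cast hcon
  have hr : 8 * (k : ℝ) ≤ R.card := by exact_mod_cast hR
  set r : ℝ := (R.card : ℝ)
  set a : ℝ := ((R.filter fun u => u ⬝ᵥ x ∉ B).card : ℝ)
  set b : ℝ := (B.card : ℝ)
  have hk' : (0 : ℝ) < k := by exact_mod_cast hk0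
  have hb0 : 0 ≤ b := Nat.cast_nonneg _
  have hr0 : 0 < r := by linarith
  -- More than `3r/4` elements lie over `B`, whose fair share is at most `r/2`. Squaring, `k²r²/16 <
  -- k³r/2`, that is `r < 8k`, against the hypothesis.
  have h1 : k * r / 4 < k * (r - a) - b * r := by nlinarith
  have h2 : (k * r / 4) ^ 2 < (k * (r - a) - b * r) ^ 2 := by
    have : 0 ≤ k * r / 4 := by positivity
    gcongr
  have h3 : (k * (r - a) - b * r) ^ 2 ≤ b * (k ^ 2 * r) :=
    hcs.trans (mul_le_mul_of_nonneg_left (hsub.trans hvar) hb0)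
  have h4 : b * (k ^ 2 * r) ≤ k / 2 * (k ^ 2 * r) :=
    mul_le_mul_of_nonneg_right (by linarith) (by positivity)
  have h5 : (k : ℝ) ^ 2 * r * (8 * k) ≤ k ^ 2 * r * r :=
    mul_le_mul_of_nonneg_left hr (by positivity)
  nlinarith

end Hashing

/-! ### The classes -/

section Classes

variable {K : Type*} [Field K]

theorem zero_mem_sparseClass (n : ℕ) : (0 : ℤ → K) ∈ sparseClass K n := by
  simp [sparseClass]

/-- The function of `starClass K n` that is `u ⬝ᵥ x` on vectors and `0` on integers. -/
def dotFun {n : ℕ} (u : Fin n → K) : (Fin n → K) ⊕ ℤ → K :=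
  Sum.elim (fun x => u ⬝ᵥ x) 0

theorem dotFun_mem_starClass {n : ℕ} (u : Fin n → K) : dotFun u ∈ starClass K n :=
  ⟨_, ⟨dotProductBilin K K u, fun _ => rfl⟩, 0, zero_mem_sparseClass n, rfl⟩

theorem starClass_dominates_linearClass (n : ℕ) :
    Dominates (starClass K n) (linearClass K n) :=
  ⟨fun f => ⟨Sum.elim f.1 0, f.1, f.2, 0, zero_mem_sparseClass n, rfl⟩, Sum.inl,
    fun _ => Equiv.refl K, fun _ _ => rfl⟩

theorem starClass_dominates_sparseClass (n : ℕ) :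
    Dominates (starClass K n) (sparseClass K n) :=
  ⟨fun h => ⟨Sum.elim (fun _ => 0) h.1, fun _ => 0, ⟨0, fun _ => rfl⟩, h.1, h.2, rfl⟩, Sum.inr,
    fun _ => Equiv.refl K, fun _ _ => rfl⟩

/-! ### Bandit feedback -/

/-- Each stage spends `k / 2` rejections on one evenly hashing vector and keeps a quarter of the
candidates. The factor `2k` leaves the `8k` candidates that the last stage needs. -/
theorem canReject_dotFun [Fintype K] {n : ℕ} (J : ℕ) (R : Finset (Fin n → K))
    (hR : 2 * Fintype.card K * 4 ^ J ≤ R.card) :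
    CanReject (dotFun '' (R : Set (Fin n → K))) (J * (Fintype.card K / 2)) := by
  classical
  have hk : 0 < Fintype.card K := Fintype.card_pos
  induction J generalizing R with
  | zero =>
    have hne : R.Nonempty := Finset.card_pos.1 (by omega)
    rw [Nat.zero_mul]
    exact hne.to_set.image _
  | succ J ih =>
    have h4 : 1 ≤ 4 ^ J := Nat.one_le_pow _ _ (by norm_num)
    rw [pow_succ] at hR
    obtain ⟨x, hx⟩ := exists_even_hash R (by nlinarith)
    rw [Nat.succ_mul, Nat.add_comm]
    refine CanReject.repeat_input (Sum.inl x) fun B hB => ?_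
    refine (ih (R.filter fun u => u ⬝ᵥ x ∉ B) ?_).mono ?_
    · have := hx B hB
      nlinarith
    · rintro _ ⟨u, hu, rfl⟩
      have hu' := Finset.mem_filter.1 (Finset.mem_coe.1 hu)
      exact ⟨⟨u, hu'.1, rfl⟩, hu'.2⟩

theorem mul_le_optBs_starClass [Fintype K] (n J : ℕ)
    (h : 2 * Fintype.card K * 4 ^ J ≤ Fintype.card K ^ n) :
    ((J * (Fintype.card K / 2) : ℕ) : ℕ∞) ≤ optBs (starClass K n) := by
  refine ((canReject_dotFun J (Finset.univ : Finset (Fin n → K)) ?_).mono ?_).le_optBs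
  · simpa using h
  · rintro _ ⟨u, -, rfl⟩
    exact dotFun_mem_starClass u

theorem one_le_optBs_starClass {n : ℕ} (hn : 0 < n) :
    ((1 : ℕ) : ℕ∞) ≤ optBs (starClass K n) := by
  refine CanReject.le_optBs ⟨Sum.inl fun _ => 1, fun y => ?_⟩
  obtain ⟨z, hz⟩ := exists_ne y
  refine ⟨_, dotFun_mem_starClass (Pi.single ⟨0, hn⟩ z), ?_⟩
  simpa [dotFun] using hz

theorem ofReal_le_optBs_starClass [Fintype K] {n : ℕ} (hn : 2 ≤ n) :
    ENNReal.ofReal (1 / 200 * (n * Fintype.card K * Real.log (Fintype.card K))) ≤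
      ((optBs (starClass K n) : ℕ∞) : ℝ≥0∞) := by
  set k := Fintype.card K with hkdef
  have hk : 2 ≤ k := Fintype.one_lt_card
  suffices h : ∃ t : ℕ, (t : ℕ∞) ≤ optBs (starClass K n) ∧
      1 / 200 * (n * k * Real.log k) ≤ (t : ℝ) by
    obtain ⟨t, ht, hle⟩ := h
    calc ENNReal.ofReal (1 / 200 * (n * k * Real.log k)) ≤ ENNReal.ofReal t :=
          ENNReal.ofReal_le_ofReal hle
      _ = ((t : ℕ∞) : ℝ≥0∞) := by simp
      _ ≤ _ := ENat.toENNReal_mono ht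
  obtain ⟨m, rfl⟩ : ∃ m, n = m + 1 := ⟨n - 1, by omega⟩
  have hm : 1 ≤ m := by omega
  have hkm : k ≤ k ^ m := Nat.le_self_pow (by omega) k
  have hk' : (2 : ℝ) ≤ k := by exact_mod_cast hk
  have hm' : (1 : ℝ) ≤ m := by exact_mod_cast hm
  have hlog0 : 0 ≤ Real.log k := Real.log_nonneg (by linarith)
  -- The largest number of stages with `2k * 4 ^ J ≤ k ^ n`, where `n = m + 1`.
  set J := Nat.log 4 (k ^ m / 2) with hJ
  have hJle : 4 ^ J ≤ k ^ m / 2 := Nat.pow_log_le_self 4 (by omega)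
  have hJlt : k ^ m / 2 < 4 ^ (J + 1) := Nat.lt_pow_succ_log_self (by norm_num) _
  rcases Nat.eq_zero_or_pos J with h0 | hpos
  -- No stage fits only if `k ^ m < 8`; then the target is at most `126 / 200`, and one mistake
  -- suffices.
  · refine ⟨1, one_le_optBs_starClass (by omega), ?_⟩
    rw [h0] at hJlt
    have hlt : k ^ m < 8 := by omega
    have hm3 : m < 3 := by
      by_contra! hge
      have h1 : 2 ^ 3 ≤ 2 ^ m := Nat.pow_le_pow_right (by norm_num) hge
      have h2 : 2 ^ m ≤ k ^ m := Nat.pow_le_pow_left hk m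
      omega
    have hk7 : (k : ℝ) ≤ 7 := by exact_mod_cast (show k ≤ 7 by omega)
    have hm2 : (m : ℝ) ≤ 2 := by exact_mod_cast (show m ≤ 2 by omega)
    have hlog : Real.log k ≤ 6 := by
      have := Real.log_le_sub_one_of_pos (show (0 : ℝ) < k by linarith)
      linarith
    have : ((m + 1 : ℕ) : ℝ) * k * Real.log k ≤ 3 * 7 * 6 := by
      push_cast
      gcongr
      linarith
    push_cast at this ⊢
    linarith
  · refine ⟨J * (k / 2), mul_le_optBs_starClass (m + 1) J ?_, ?_⟩
    · rw [pow_succ, ← hkdef]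
      have : 2 * 4 ^ J ≤ k ^ m := by omega
      nlinarith
    -- The exponent `2J + 3` is at most `5J` because `J ≥ 1`.
    have hpow : k ^ m ≤ 2 ^ (5 * J) := by
      have h1 : k ^ m ≤ 2 * 4 ^ (J + 1) := by omega
      refine h1.trans ?_
      rw [show (4 : ℕ) = 2 ^ 2 by norm_num, ← pow_mul, ← pow_succ']
      exact Nat.pow_le_pow_right (by norm_num) (by omega)
    have hlog : m * Real.log k ≤ 5 * J := by
      have h1 : Real.log ((k : ℝ) ^ m) ≤ Real.log ((2 : ℝ) ^ (5 * J)) :=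
        Real.log_le_log (by positivity) (by exact_mod_cast hpow)
      rw [Real.log_pow, Real.log_pow] at h1
      have h2 : Real.log 2 ≤ 1 := by
        have := Real.log_le_sub_one_of_pos (show (0 : ℝ) < 2 by norm_num)
        linarith
      refine h1.trans ?_
      push_cast
      exact mul_le_of_le_one_right (by positivity) h2
    have hhalf : (k : ℝ) ≤ 3 * (k / 2 : ℕ) := by exact_mod_cast (show k ≤ 3 * (k / 2) by omega)
    calc 1 / 200 * (((m + 1 : ℕ) : ℝ) * k * Real.log k)
        ≤ 1 / 200 * ((2 * m) * k * Real.log k) := by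
          push_cast
          gcongr
          linarith
      _ = 1 / 100 * k * (m * Real.log k) := by ring
      _ ≤ 1 / 100 * (3 * (k / 2 : ℕ)) * (5 * J) := by gcongr
      _ ≤ ((J * (k / 2) : ℕ) : ℝ) := by
          push_cast
          have : (0 : ℝ) ≤ (J : ℝ) * (k / 2 : ℕ) := by positivity
          linarith

/-- The standard basis, padded with zero vectors, is a single input at which the `k ^ n` linear maps
give distinct answers; the adversary repeats it. -/
theorem le_optBs_CART_starClass [Fintype K] {n r : ℕ} (hr : n ≤ r) :
    ((Fintype.card K ^ n - 1 : ℕ) : ℕ∞) ≤ optBs (CART r (starClass K n)) := by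
  classical
  let x : Fin r → (Fin n → K) ⊕ ℤ := fun i =>
    Sum.inl (if h : (i : ℕ) < n then Pi.single ⟨i, h⟩ 1 else 0)
  let g : (Fin n → K) → Fin r → K := fun u i => dotFun u (x i)
  have hg : Function.Injective g := by
    intro u v huv
    ext j
    have := congrFun huv (Fin.castLE hr j)
    simpa [g, x, dotFun] using this
  refine CanReject.le_optBs ?_
  rw [← Nat.add_zero (Fintype.card K ^ n - 1)]
  refine CanReject.repeat_input x fun B hB => ?_
  have hlt : B.card < (Finset.univ.image g).card := by
    rw [Finset.card_image_of_injective _ hg, Finset.card_univ, Fintype.card_fun, Fintype.card_fin]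
    have : 0 < Fintype.card K ^ n := pow_pos Fintype.card_pos n
    omega
  obtain ⟨w, hw, hwB⟩ := Finset.exists_mem_notMem_of_card_lt_card hlt
  obtain ⟨u, -, rfl⟩ := Finset.mem_image.1 hw
  exact ⟨fun z i => dotFun u (z i), ⟨dotFun u, dotFun_mem_starClass u, fun _ _ => rfl⟩, hwB⟩

/-! ### Standard feedback -/

open Classical in
/-- On a vector, guess by some linear map that agrees with the history; on an integer, repeat the
known output, and guess `0` if there is none. -/
noncomputable def consistentLearner (K : Type*) [Field K] (n : ℕ) :
    Learner ((Fin n → K) ⊕ ℤ) K K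
  | H, Sum.inl x =>
      if h : ∃ L : (Fin n → K) →ₗ[K] K, ∀ v y z, (Sum.inl v, y, z) ∈ H → L v = z then
        h.choose x
      else 0
  | H, Sum.inr a => if h : ∃ z, ∃ y, (Sum.inr a, y, z) ∈ H then h.choose else 0

/-- The vectors among the inputs of a history. -/
def queriedVectors {n : ℕ} (H : List (((Fin n → K) ⊕ ℤ) × K × K)) : Set (Fin n → K) :=
  {v | Sum.inl v ∈ H.map Prod.fst}

/-- The integers with nonzero output under `h` among the inputs of a history. -/
def queriedSupport {n : ℕ} (h : ℤ → K) (H : List (((Fin n → K) ⊕ ℤ) × K × K)) : Set ℤ :=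
  {a | h a ≠ 0 ∧ Sum.inr a ∈ H.map Prod.fst}

/-- The potential, rank of the queried vectors plus number of support points seen, never exceeds `2
* n` and grows with each mistake. -/
theorem mistakes_consistentLearner_add_le {n : ℕ} (L : (Fin n → K) →ₗ[K] K) {h : ℤ → K}
    (hh : h ∈ sparseClass K n) (xs : List ((Fin n → K) ⊕ ℤ))
    (H : List (((Fin n → K) ⊕ ℤ) × K × K))
    (hH : ∀ x y z, (x, y, z) ∈ H → z = Sum.elim L h x) :
    mistakes (fun truth _ : K => truth) (consistentLearner K n) (Sum.elim L h) H xs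
      + (Module.finrank K (Submodule.span K (queriedVectors H)) + (queriedSupport h H).ncard)
      ≤ 2 * n := by
  classical
  have hfin : {a : ℤ | h a ≠ 0}.Finite := Set.finite_of_encard_le_coe hh
  have hcard : {a : ℤ | h a ≠ 0}.ncard ≤ n := by
    have : ({a : ℤ | h a ≠ 0}.ncard : ℕ∞) ≤ n := by
      rw [hfin.cast_ncard_eq]
      exact hh
    exact_mod_cast this
  have hsub : ∀ H, queriedSupport h H ⊆ {a : ℤ | h a ≠ 0} :=
    fun (H : List (((Fin n → K) ⊕ ℤ) × K × K)) a ha => ha.1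
  induction xs generalizing H with
  | nil =>
    have h1 := Submodule.finrank_le (Submodule.span K (queriedVectors H))
    rw [Module.finrank_fin_fun] at h1
    have h2 := Set.ncard_le_ncard (hsub H) hfin
    simp only [mistakes]
    omega
  | cons x xs ih =>
    set A := consistentLearner K n
    set H' : List (((Fin n → K) ⊕ ℤ) × K × K) := (x, A H x, Sum.elim L h x) :: H with hH'
    have hrec := ih H' (by
      intro x' y z hmem
      rcases List.mem_cons.1 hmem with heq | hmem
      · simp only [Prod.mk.injEq] at heq
        rw [heq.1, heq.2.2]
      · exact hH x' y z hmem)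
    have hV : queriedVectors H ⊆ queriedVectors H' := fun v hv => List.mem_cons_of_mem _ hv
    have hS : queriedSupport h H ⊆ queriedSupport h H' :=
      fun a ha => ⟨ha.1, List.mem_cons_of_mem _ ha.2⟩
    have hspan := Submodule.span_mono (R := K) hV
    have hV' := Submodule.finrank_mono hspan
    have hS' := Set.ncard_le_ncard hS (hfin.subset (hsub H'))
    have hgain : (if A H x = Sum.elim L h x then 0 else 1)
        + (Module.finrank K (Submodule.span K (queriedVectors H)) + (queriedSupport h H).ncard)
        ≤ Module.finrank K (Submodule.span K (queriedVectors H'))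
          + (queriedSupport h H').ncard := by
      split_ifs with hguess
      · omega
      rcases x with v | a
      · have hlt : Submodule.span K (queriedVectors H) < Submodule.span K (queriedVectors H') := by
          -- If the span did not grow, `v` would lie in the old span, where every consistent linear
          -- map agrees with `L`, so the guess would be correct.
          refine lt_of_le_of_ne hspan fun heq => hguess ?_
          have hv : v ∈ Submodule.span K (queriedVectors H) := by
            rw [heq]
            exact Submodule.subset_span (by simp [queriedVectors, hH'])
          have hex : ∃ L : (Fin n → K) →ₗ[K] K, ∀ v y z, (Sum.inl v, y, z) ∈ H → L v = z :=
            ⟨L, fun v y z hm => (hH _ _ _ hm).symm⟩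
          have hA : A H (Sum.inl v) = hex.choose v := dif_pos hex
          rw [hA, Sum.elim_inl]
          refine LinearMap.eqOn_span (fun w hw => ?_) hv
          obtain ⟨⟨_, y, z⟩, hm, rfl⟩ := List.mem_map.1 hw
          exact (hex.choose_spec w y z hm).trans (hH _ _ _ hm)
        have := Submodule.finrank_lt_finrank_of_lt hlt
        omega
      · have hlt : queriedSupport h H ⊂ queriedSupport h H' := by
          -- A known output is repeated correctly, so the integer is new; the default guess `0`
          -- failed, so it lies in the support.
          have hnew : ¬ ∃ z, ∃ y, (Sum.inr a, y, z) ∈ H := by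
            intro hex
            refine hguess ?_
            have hA : A H (Sum.inr a) = hex.choose := dif_pos hex
            rw [hA]
            obtain ⟨y, hy⟩ := hex.choose_spec
            exact hH _ _ _ hy
          have hA : A H (Sum.inr a) = 0 := dif_neg hnew
          rw [hA, Sum.elim_inr] at hguess
          refine (Set.ssubset_iff_of_subset hS).2 ⟨a, ⟨Ne.symm hguess, by simp [hH']⟩, ?_⟩
          rintro ⟨-, hmem⟩
          obtain ⟨⟨_, y, z⟩, hm, rfl⟩ := List.mem_map.1 hmem
          exact hnew ⟨z, y, hm⟩
        have := Set.ncard_lt_ncard hlt (hfin.subset (hsub H'))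
        omega
    simp only [mistakes]
    rw [← hH']
    omega

theorem optStd_starClass_le (n : ℕ) : optStd (starClass K n) ≤ ((2 * n : ℕ) : ℕ∞) := by
  refine iInf_le_of_le (consistentLearner K n) ?_
  refine iSup₂_le fun f hf => iSup_le fun xs => ?_
  obtain ⟨g, ⟨L, hL⟩, h, hh, rfl⟩ := hf
  obtain rfl : g = L := funext hL
  have := mistakes_consistentLearner_add_le L hh xs [] (by simp)
  exact_mod_cast (by omega)

end Classes

end OnlineLearning

theorem mainTheorem11 :
    ∃ c : ℝ, 0 < c ∧ ∀ k n : ℕ, IsPrimePow k → 2 ≤ n →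
      ∃ (K : Type) (_ : Field K) (_ : Fintype K), Fintype.card K = k ∧
        OnlineLearning.Dominates (OnlineLearning.starClass K n) (OnlineLearning.linearClass K n) ∧
        OnlineLearning.Dominates (OnlineLearning.starClass K n) (OnlineLearning.sparseClass K n) ∧
        OnlineLearning.optStd (OnlineLearning.starClass K n) ≤ ((2 * n : ℕ) : ℕ∞) ∧
        ENNReal.ofReal (c * (n * k * Real.log k)) ≤
          ((OnlineLearning.optBs (OnlineLearning.starClass K n) : ℕ∞) : ℝ≥0∞) ∧
        ∀ r : ℕ, n ≤ r →
          ((k ^ n - 1 : ℕ) : ℕ∞) ≤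
            OnlineLearning.optBs (OnlineLearning.CART r (OnlineLearning.starClass K n)) := by
  refine ⟨1 / 200, by norm_num, fun k n hk hn => ?_⟩
  obtain ⟨p, m, hp, hm, rfl⟩ := (isPrimePow_nat_iff k).1 hk
  have : Fact p.Prime := ⟨hp⟩
  let _ : Fintype (GaloisField p m) := Fintype.ofFinite _
  have hcard : Fintype.card (GaloisField p m) = p ^ m := by
    rw [← Nat.card_eq_fintype_card, GaloisField.card p m hm.ne']
  refine ⟨GaloisField p m, inferInstance, inferInstance, hcard,
    OnlineLearning.starClass_dominates_linearClass n,
    OnlineLearning.starClass_dominates_sparseClass n,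
    OnlineLearning.optStd_starClass_le n, ?_, fun r hr => ?_⟩
  · rw [← hcard]
    exact OnlineLearning.ofReal_le_optBs_starClass hn
  · rw [← hcard]
    exact OnlineLearning.le_optBs_CART_starClass hr
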